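/- Let $d\ge 1$ be an integer, $\mathbb{D}=\{z\in\mathbb{C}:|z|<1\}$, and let $A_{\mathrm{sym}}(\mathbb{D}^d)$ be the complex unital commutative Banach algebra (with pointwise operations and the supremum norm) of all continuous functions $f:\overline{\mathbb{D}}^d\to\mathbb{C}$ that are holomorphic in $\mathbb{D}^d$ and symmetric, i.e. $f(z_{\sigma(1)},\dots,z_{\sigma(d)})=f(z_1,\dots,z_d)$ for all $(z_1,\dots,z_d)\in\mathbb{D}^d$ and all permutations $\sigma$ of $\{1,\dots,d\}$. Let $M$ be the maximal ideal space of $A_{\mathrm{sym}}(\mathbb{D}^d)$, i.e. the set of all nonzero complex algebra homomorphisms $\varphi:A_{\mathrm{sym}}(\mathbb{D}^d)\to\mathbb{C}$ (each of which is automatically continuous), endowed with the Gelfand topology, i.e. the topology induced from the weak-$*$ topology of the dual space of $A_{\mathrm{sym}}(\mathbb{D}^d)$. Then $M$ is contractible: there exist a point $\varphi_0\in M$ and a continuous map $H:[0,1]\times M\to M$ such that $H(0,\varphi)=\varphi$ and $H(1,\varphi)=\varphi_0$ for all $\varphi\in M$. -/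

import Mathlib

/-- The open polydisc `𝔻^d` in `ℂ^d`. -/
def openPolydisc (d : ℕ) : Set (Fin d → ℂ) := {z | ∀ i, ‖z i‖ < 1}

/-- The closed polydisc in `ℂ^d`, the closure of `𝔻^d`. -/
def closedPolydisc (d : ℕ) : Set (Fin d → ℂ) := {z | ∀ i, ‖z i‖ ≤ 1}

theorem openPolydisc_subset_closedPolydisc (d : ℕ) : openPolydisc d ⊆ closedPolydisc d :=
  fun _ hz i => (hz i).le

/-- The closed polydisc is compact, so that `C(closedPolydisc d, ℂ)` carries the supremum norm. -/
instance closedPolydisc_compactSpace (d : ℕ) : CompactSpace (closedPolydisc d) := by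
  rw [← isCompact_iff_compactSpace]
  have h : closedPolydisc d = Set.univ.pi fun _ => Metric.closedBall (0 : ℂ) 1 := by
    ext z
    simp [closedPolydisc]
  rw [h]
  exact isCompact_univ_pi fun _ => isCompact_closedBall _ _

/-- The action of `S_d` on the closed polydisc, `σ z = (z_{σ(1)}, …, z_{σ(d)})`. -/
def permPoint {d : ℕ} (σ : Equiv.Perm (Fin d)) (z : closedPolydisc d) : closedPolydisc d :=
  ⟨fun i => z.1 (σ i), fun i => z.2 (σ i)⟩

/-- `f`, defined on the closed polydisc, is holomorphic in the open polydisc. -/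
def IsHolomorphicInside {d : ℕ} (f : closedPolydisc d → ℂ) : Prop :=
  ∃ g : (Fin d → ℂ) → ℂ, DifferentiableOn ℂ g (openPolydisc d) ∧
    ∀ z : closedPolydisc d, z.1 ∈ openPolydisc d → f z = g z.1

/-- `f(σ z) = f(z)` for all `z ∈ 𝔻^d` and all permutations `σ`. -/
def IsSymmetricInside {d : ℕ} (f : closedPolydisc d → ℂ) : Prop :=
  ∀ z : closedPolydisc d, z.1 ∈ openPolydisc d →
    ∀ σ : Equiv.Perm (Fin d), f z = f (permPoint σ z)

/-- The polydisc algebra `A(𝔻^d)`: continuous on the closed polydisc and holomorphic in `𝔻^d`,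
with pointwise operations and the supremum norm. -/
def polydiscAlgebra (d : ℕ) : Subalgebra ℂ C(closedPolydisc d, ℂ) where
  carrier := {f | IsHolomorphicInside f}
  mul_mem' := by
    rintro f₁ f₂ ⟨g₁, h₁, e₁⟩ ⟨g₂, h₂, e₂⟩
    exact ⟨g₁ * g₂, h₁.mul h₂, fun z hz => by simp [e₁ z hz, e₂ z hz]⟩
  add_mem' := by
    rintro f₁ f₂ ⟨g₁, h₁, e₁⟩ ⟨g₂, h₂, e₂⟩
    exact ⟨g₁ + g₂, h₁.add h₂, fun z hz => by simp [e₁ z hz, e₂ z hz]⟩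
  algebraMap_mem' c := ⟨fun _ => c, differentiableOn_const c, fun _ _ => by simp⟩

/-- The algebra `A_sym(𝔻^d)` of symmetric functions in the polydisc algebra, with the same
operations and norm. -/
def symPolydiscAlgebra (d : ℕ) : Subalgebra ℂ C(closedPolydisc d, ℂ) where
  carrier := {f | f ∈ polydiscAlgebra d ∧ IsSymmetricInside f}
  mul_mem' := by
    rintro f₁ f₂ ⟨h₁, s₁⟩ ⟨h₂, s₂⟩
    exact ⟨mul_mem h₁ h₂, fun z hz σ => by simp [← s₁ z hz σ, ← s₂ z hz σ]⟩
  add_mem' := by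
    rintro f₁ f₂ ⟨h₁, s₁⟩ ⟨h₂, s₂⟩
    exact ⟨add_mem h₁ h₂, fun z hz σ => by simp [← s₁ z hz σ, ← s₂ z hz σ]⟩
  algebraMap_mem' c := ⟨(polydiscAlgebra d).algebraMap_mem c, fun _ _ _ => by simp⟩

/-! The polydisc is star-shaped about its centre, and the scalings `z ↦ (1 - t) z` preserve
holomorphy and commute with permutations. Composition with them therefore gives endomorphisms of the
algebra running from the identity to evaluation at `0`; dualizing contracts the character space. The
analytic point is joint continuity of `(t, φ) ↦ φ (dilation t f)`, which needs the uniform bound `‖φ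
f‖ ≤ ‖f‖`. -/

open Filter Topology unitInterval

/-- A character of an algebra of continuous functions is contractive for the supremum norm; the
algebra need not be closed. -/
theorem norm_characterSpace_apply_le {X : Type*} [TopologicalSpace X] [CompactSpace X]
    {S : Subalgebra ℂ C(X, ℂ)} (φ : WeakDual.characterSpace ℂ S) (f : S) : ‖φ f‖ ≤ ‖f‖ := by
  by_contra! h
  obtain ⟨C, hC, hφ⟩ := (WeakDual.toStrongDual (φ : WeakDual ℂ S)).bound
  -- Multiplicativity applies the bound to all powers of `f`, so a ratio `‖φ f‖ / ‖f‖ > 1` would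
  -- have powers exceeding `C`.
  have hbound : ∀ n : ℕ, 0 < n → ‖φ f‖ ^ n ≤ C * ‖f‖ ^ n := fun n hn =>
    calc ‖φ f‖ ^ n = ‖φ (f ^ n)‖ := by rw [map_pow, norm_pow]
      _ ≤ C * ‖f ^ n‖ := hφ (f ^ n)
      _ ≤ C * ‖f‖ ^ n := by gcongr; exact norm_pow_le' f hn
  rcases (norm_nonneg f).eq_or_lt with h0 | h0
  · have := hbound 1 one_pos
    simp only [pow_one] at this
    rw [← h0, mul_zero] at this
    linarith
  · obtain ⟨n, hn⟩ := pow_unbounded_of_one_lt C ((one_lt_div h0).2 h)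
    have hn' := hn.trans (pow_lt_pow_right₀ ((one_lt_div h0).2 h) n.lt_succ_self)
    rw [div_pow, lt_div_iff₀ (pow_pos h0 _)] at hn'
    exact absurd (hbound _ n.succ_pos) (not_le.2 hn')

/-- The pairing of characters with a norm-continuous family of functions is jointly continuous. -/
theorem continuous_characterSpace_apply {X T : Type*} [TopologicalSpace X] [CompactSpace X]
    [TopologicalSpace T] {S : Subalgebra ℂ C(X, ℂ)} {F : T → S} (hF : Continuous F) :
    Continuous fun p : T × WeakDual.characterSpace ℂ S => p.2 (F p.1) := by
  rw [continuous_iff_continuousAt]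
  rintro ⟨t, φ⟩
  -- The change in the function is controlled uniformly over characters; the change in the character
  -- is tested on the fixed element `F t`, where weak-* continuity suffices.
  have hsmall : Tendsto (fun p : T × WeakDual.characterSpace ℂ S => p.2 (F p.1 - F t))
      (𝓝 (t, φ)) (𝓝 0) := by
    refine squeeze_zero_norm (fun p => norm_characterSpace_apply_le p.2 _) ?_
    have h : Continuous fun p : T × WeakDual.characterSpace ℂ S => ‖F p.1 - F t‖ :=
      ((hF.comp continuous_fst).sub continuous_const).norm
    have h0 := h.tendsto (t, φ)
    rwa [sub_self, norm_zero] at h0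
  have hfixed : Tendsto (fun p : T × WeakDual.characterSpace ℂ S => p.2 (F t))
      (𝓝 (t, φ)) (𝓝 (φ (F t))) :=
    ((WeakDual.eval_continuous (F t)).comp
      (continuous_subtype_val.comp continuous_snd)).tendsto (t, φ)
  have hsum := hsmall.add hfixed
  rw [zero_add] at hsum
  refine hsum.congr fun p => ?_
  rw [map_sub, sub_add_cancel]

/-- The contraction `z ↦ (1 - t) z` of the closed polydisc. -/
def shrinkPoint {d : ℕ} (t : I) (z : closedPolydisc d) : closedPolydisc d :=
  ⟨fun i => ((σ t : ℝ) : ℂ) * z.1 i, fun i => by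
    rw [norm_mul, Complex.norm_of_nonneg (σ t).2.1]
    exact mul_le_one₀ (σ t).2.2 (norm_nonneg _) (z.2 i)⟩

theorem continuous_shrinkPoint (d : ℕ) :
    Continuous fun p : I × closedPolydisc d => shrinkPoint p.1 p.2 := by
  refine Continuous.subtype_mk (continuous_pi fun i => ?_) _
  exact (Complex.continuous_ofReal.comp (continuous_subtype_val.comp
    (unitInterval.continuous_symm.comp continuous_fst))).mul
    ((continuous_apply i).comp (continuous_subtype_val.comp continuous_snd))

theorem smul_mem_openPolydisc {d : ℕ} (t : I) {z : Fin d → ℂ} (hz : z ∈ openPolydisc d) :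
    (fun i => ((σ t : ℝ) : ℂ) * z i) ∈ openPolydisc d := fun i => by
  rw [norm_mul, Complex.norm_of_nonneg (σ t).2.1]
  exact mul_lt_one_of_nonneg_of_lt_one_right (σ t).2.2 (norm_nonneg _) (hz i)

/-- The contraction `z ↦ (1 - t) z` as a continuous map. -/
def shrinkMap {d : ℕ} (t : I) : C(closedPolydisc d, closedPolydisc d) :=
  ⟨shrinkPoint t, (continuous_shrinkPoint d).comp (by fun_prop : Continuous fun z => (t, z))⟩

theorem comp_shrinkMap_mem {d : ℕ} (t : I) {f : C(closedPolydisc d, ℂ)}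
    (hf : f ∈ symPolydiscAlgebra d) : f.comp (shrinkMap t) ∈ symPolydiscAlgebra d := by
  obtain ⟨⟨g, hg, hfg⟩, hs⟩ := hf
  refine ⟨⟨fun z => g fun i => ((σ t : ℝ) : ℂ) * z i, ?_, fun z hz => ?_⟩, fun z hz τ => ?_⟩
  · exact hg.comp (t := openPolydisc d) (by fun_prop) fun z hz => smul_mem_openPolydisc t hz
  · exact hfg _ (smul_mem_openPolydisc t hz)
  -- Scaling commutes with permuting coordinates definitionally.
  · exact hs _ (smul_mem_openPolydisc t hz) τ

/-- The dilation endomorphism `f ↦ f((1 - t) ·)` of the symmetric polydisc algebra. -/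
noncomputable def dilation {d : ℕ} (t : I) : symPolydiscAlgebra d →ₐ[ℂ] symPolydiscAlgebra d :=
  AlgHom.codRestrict
    ((ContinuousMap.compRightAlgHom ℂ ℂ (shrinkMap t)).comp (symPolydiscAlgebra d).val) _
    fun f => comp_shrinkMap_mem t f.2

theorem dilation_apply {d : ℕ} (t : I) (f : symPolydiscAlgebra d) (z : closedPolydisc d) :
    (dilation t f).1 z = f.1 (shrinkPoint t z) := rfl

/-- Dilations depend continuously on the parameter, in the supremum norm. -/
theorem continuous_dilation_left {d : ℕ} (f : symPolydiscAlgebra d) :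
    Continuous fun t : I => dilation t f :=
  Continuous.subtype_mk
    -- Currying a jointly continuous map gives continuity in the compact-open topology, which is the
    -- sup-norm topology on a compact space.
    (ContinuousMap.curry ⟨fun p : I × closedPolydisc d => f.1 (shrinkPoint p.1 p.2),
      f.1.continuous.comp (continuous_shrinkPoint d)⟩).continuous _

theorem continuous_dilation {d : ℕ} (t : I) :
    Continuous (dilation t : symPolydiscAlgebra d → symPolydiscAlgebra d) :=
  Continuous.subtype_mk
    ((ContinuousMap.continuous_precomp (shrinkMap t)).comp continuous_subtype_val) _

/-- The centre of the closed polydisc. -/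
def polydiscCenter (d : ℕ) : closedPolydisc d := ⟨0, fun i => by simp⟩

theorem dilation_zero {d : ℕ} (f : symPolydiscAlgebra d) : dilation 0 f = f := by
  refine Subtype.ext (ContinuousMap.ext fun z => ?_)
  rw [dilation_apply]
  congr 1
  exact Subtype.ext (funext fun i => by simp [shrinkPoint])

/-- All characters agree on constants, so the homotopy ends at a single point. -/
theorem dilation_one {d : ℕ} (f : symPolydiscAlgebra d) :
    dilation 1 f = algebraMap ℂ (symPolydiscAlgebra d) (f.1 (polydiscCenter d)) := by
  refine Subtype.ext (ContinuousMap.ext fun z => ?_)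
  rw [dilation_apply]
  refine congrArg f.1 (Subtype.ext (funext fun i => ?_))
  simp [shrinkPoint, polydiscCenter]

/-- A unital algebra homomorphism that is continuous, as a point of the character space. -/
noncomputable def characterOfAlgHom {A : Type*} [NormedRing A] [NormedAlgebra ℂ A] (φ : A →ₐ[ℂ] ℂ)
    (hφ : Continuous φ) : WeakDual.characterSpace ℂ A :=
  ⟨StrongDual.toWeakDual ⟨φ.toLinearMap, hφ⟩, by
    rw [WeakDual.CharacterSpace.eq_set_map_one_map_mul]
    exact ⟨map_one φ, map_mul φ⟩⟩

/-- The action of the dilations on the character space. -/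
noncomputable def dilateCharacter {d : ℕ} (t : I) (φ : WeakDual.characterSpace ℂ (symPolydiscAlgebra d)) :
    WeakDual.characterSpace ℂ (symPolydiscAlgebra d) :=
  characterOfAlgHom ((WeakDual.CharacterSpace.toAlgHom φ).comp (dilation t))
    ((map_continuous φ).comp (continuous_dilation t))

theorem dilateCharacter_apply {d : ℕ} (t : I)
    (φ : WeakDual.characterSpace ℂ (symPolydiscAlgebra d)) (f : symPolydiscAlgebra d) :
    dilateCharacter t φ f = φ (dilation t f) := rfl

theorem continuous_dilateCharacter (d : ℕ) :
    Continuous fun p : I × WeakDual.characterSpace ℂ (symPolydiscAlgebra d) =>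
      dilateCharacter p.1 p.2 := by
  refine Continuous.subtype_mk (WeakDual.continuous_of_continuous_eval fun f => ?_) _
  exact continuous_characterSpace_apply (continuous_dilation_left f)

/-- Evaluation at the centre of the polydisc. -/
noncomputable def evalCenter (d : ℕ) : WeakDual.characterSpace ℂ (symPolydiscAlgebra d) :=
  characterOfAlgHom
    ((ContinuousMap.evalAlgHom ℂ ℂ (polydiscCenter d)).comp (symPolydiscAlgebra d).val)
    ((continuous_eval_const (polydiscCenter d)).comp continuous_subtype_val)

theorem evalCenter_apply {d : ℕ} (f : symPolydiscAlgebra d) :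
    evalCenter d f = f.1 (polydiscCenter d) := rfl

/-- The maximal ideal space of `A_sym(𝔻^d)` (the nonzero multiplicative functionals, with the
topology induced by the weak-* topology of the dual) is contractible. -/
theorem theorem4p1 (d : ℕ) (hd : 1 ≤ d) :
    ContractibleSpace (WeakDual.characterSpace ℂ (symPolydiscAlgebra d)) := by
  refine (contractible_iff_id_nullhomotopic _).2 ⟨evalCenter d, ⟨?_⟩⟩
  refine ⟨⟨fun p => dilateCharacter p.1 p.2, continuous_dilateCharacter d⟩, fun φ => ?_,
    fun φ => ?_⟩
  · refine WeakDual.CharacterSpace.ext fun f => ?_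
    change dilateCharacter 0 φ f = φ f
    rw [dilateCharacter_apply, dilation_zero]
  · refine WeakDual.CharacterSpace.ext fun f => ?_
    change dilateCharacter 1 φ f = evalCenter d f
    rw [dilateCharacter_apply, dilation_one, AlgHomClass.commutes, evalCenter_apply]
    rfl
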